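/- Conventions. An $m$-current in $\mathbb{R}^d$ (always compactly supported) is a continuous linear functional $T$ on the space $C^\infty(\mathbb{R}^d;\wedge^m\mathbb{R}^d)$ of smooth $m$-forms with the topology of uniform convergence of all derivatives on compact sets; $\operatorname{spt} T$ is the smallest compact set such that $T$ vanishes on all forms supported in its complement. The boundary of $T$ ($m\ge 1$) is $\partial T(\omega)=T(d\omega)$. With $\|\omega\|_\infty$ the supremum of the pointwise comass norms of $\omega$, the mass of $T$ is $\mathbf{M}(T)=\sup\{T(\omega):\|\omega\|_\infty\le 1\}$, and its normal mass is $\mathbf{N}(T)=\mathbf{M}(T)+\mathbf{M}(\partial T)$ if $m\ge 1$, $\mathbf{N}(T)=\mathbf{M}(T)$ if $m=0$; $T$ is normal if $\mathbf{N}(T)<\infty$. The flat norm is $\mathbf{F}(T)=\sup\{T(\omega):\|\omega\|_\infty\le 1,\ \|d\omega\|_\infty\le 1\}$. The current $T$ is flat if there is an $\mathbf{F}$-Cauchy sequence of normal $m$-currents, supported in a common compact set, that converges to $T$ on every compactly supported smooth $m$-form (then $\mathbf{F}(T)$ is the limit of the flat norms of the terms of this sequence). For $\alpha\in[0,1]$,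 a flat $m$-current $T$ is $\alpha$-fractional if there is a sequence $(T_k)_{k\ge 0}$ of normal $m$-currents, supported in a common compact set, such that $$\sum_{k=0}^\infty \mathbf{N}(T_k)^{1-\alpha}\,\mathbf{F}(T_k)^{\alpha}<\infty \qquad\text{and}\qquad \lim_{n\to\infty}\mathbf{F}\Big(T-\sum_{k=0}^{n-1}T_k\Big)=0$$ (with $0^0=1$). For a bounded set $A\subset\mathbb{R}^d$ and an integer $k\ge 0$, let $N_A(k)$ be the number of dyadic cubes $\prod_{i=1}^d[\ell_i2^{-k},(\ell_i+1)2^{-k}]$, $\ell_1,\dots,\ell_d\in\mathbb{Z}$, that meet $A$; for a real number $s$, $A$ is $s$-summable if $\sum_{k=0}^\infty N_A(k)\,2^{-ks}<\infty$. For a bounded open set $U\subset\mathbb{R}^d$, $\llbracket U\rrbracket$ denotes the $d$-current $\omega\mapsto\int_U\langle\omega(x),e_1\wedge\dots\wedge e_d\rangle\,dx$. Proposition. Let $\alpha\in[0,1]$ and let $U\subset\mathbb{R}^d$ be a bounded open set whose boundary $\partial U$ is $(d-1+\alpha)$-summable. Then $\llbracket U\rrbracket$ is an $\alpha$-fractional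 $d$-current. -/

import Mathlib

open Set Filter Topology MeasureTheory
open scoped ENNReal

noncomputable section

namespace FractionalCurrents

/-- Euclidean space `ℝ^d`. -/
abbrev E (d : ℕ) : Type := EuclideanSpace ℝ (Fin d)

/-- The space `∧^m ℝ^d` of `m`-covectors: (continuous) alternating `m`-linear forms on `ℝ^d`.
Its Mathlib norm `‖φ‖ = sup {|φ(v₁, …, v_m)| : ‖v_i‖ ≤ 1}` is the comass norm: by Hadamard's
inequality `|v₁ ∧ … ∧ v_m| ≤ ∏ ‖v_i‖`, with equality for orthogonal vectors, and every simple
`m`-vector is the exterior product of orthogonal vectors. -/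
abbrev Covector (d m : ℕ) : Type := E d [⋀^Fin m]→L[ℝ] ℝ

/-! ### Smooth forms -/

/-- The smooth `m`-forms on `ℝ^d` (with arbitrary supports), as a linear space of functions. -/
def smoothForms (d m : ℕ) : Submodule ℝ (E d → Covector d m) where
  carrier := {ω | ContDiff ℝ (⊤ : ℕ∞) ω}
  add_mem' hf hg := by
    rw [mem_ofPred_eq] at hf hg ⊢
    exact hf.add hg
  zero_mem' := contDiff_zero_fun (𝕜 := ℝ) (n := (⊤ : ℕ∞))
  smul_mem' c _ hf := by
    rw [mem_ofPred_eq] at hf ⊢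
    exact hf.const_smul c

/-- The space `C^∞(ℝ^d; ∧^m ℝ^d)`. It is a type of its own, so that it does not inherit the topology
of pointwise convergence. -/
def SmoothForm (d m : ℕ) : Type := ↥(smoothForms d m)

variable {d m : ℕ}

namespace SmoothForm

instance : AddCommGroup (SmoothForm d m) := inferInstanceAs (AddCommGroup ↥(smoothForms d m))
instance : Module ℝ (SmoothForm d m) := inferInstanceAs (Module ℝ ↥(smoothForms d m))
instance : CoeFun (SmoothForm d m) (fun _ => E d → Covector d m) := ⟨fun ω => ω.1⟩

theorem contDiff (ω : SmoothForm d m) : ContDiff ℝ (⊤ : ℕ∞) (ω : E d → Covector d m) := ω.2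

theorem add_apply (ω η : SmoothForm d m) (x : E d) : (ω + η) x = ω x + η x := rfl

theorem smul_apply (c : ℝ) (ω : SmoothForm d m) (x : E d) : (c • ω) x = c • ω x := rfl

theorem bddAbove_iteratedFDeriv (ω : SmoothForm d m) (K : TopologicalSpace.Compacts (E d))
    (i : ℕ) : BddAbove (range fun x : K => ‖iteratedFDeriv ℝ i ω (x : E d)‖) := by
  have hc : Continuous (fun x : E d => ‖iteratedFDeriv ℝ i ω x‖) :=
    (ω.contDiff.continuous_iteratedFDeriv (m := i) (by exact_mod_cast le_top)).norm
  have h := K.isCompact.bddAbove_image hc.continuousOn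
  rwa [image_eq_range] at h

/-- The seminorm `ω ↦ sup_{x ∈ K} ‖D^i ω(x)‖`, for `K ⊆ ℝ^d` compact and `i ∈ ℕ`. -/
def seminorm (d m : ℕ) (K : TopologicalSpace.Compacts (E d)) (i : ℕ) :
    Seminorm ℝ (SmoothForm d m) :=
  Seminorm.of (fun ω => ⨆ x : K, ‖iteratedFDeriv ℝ i ω (x : E d)‖)
    (by
      intro ω η
      refine Real.iSup_le (fun x => ?_) (add_nonneg (Real.iSup_nonneg fun _ => norm_nonneg _)
        (Real.iSup_nonneg fun _ => norm_nonneg _))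
      have h : iteratedFDeriv ℝ i (ω + η : SmoothForm d m) (x : E d)
          = iteratedFDeriv ℝ i ω (x : E d) + iteratedFDeriv ℝ i η (x : E d) :=
        iteratedFDeriv_add_apply
          ((ω.contDiff.of_le (by exact_mod_cast le_top)).contDiffAt)
          ((η.contDiff.of_le (by exact_mod_cast le_top)).contDiffAt)
      rw [h]
      exact (norm_add_le _ _).trans (add_le_add (le_ciSup (ω.bddAbove_iteratedFDeriv K i) x)
        (le_ciSup (η.bddAbove_iteratedFDeriv K i) x)))
    (by
      intro c ω
      have h : ∀ x : K, ‖iteratedFDeriv ℝ i (c • ω : SmoothForm d m) (x : E d)‖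
          = ‖c‖ * ‖iteratedFDeriv ℝ i ω (x : E d)‖ := by
        intro x
        have h' : iteratedFDeriv ℝ i (c • ω : SmoothForm d m) (x : E d)
            = c • iteratedFDeriv ℝ i ω (x : E d) :=
          iteratedFDeriv_const_smul_apply
            ((ω.contDiff.of_le (by exact_mod_cast le_top)).contDiffAt)
        rw [h', norm_smul]
      simp only [h]
      exact (Real.mul_iSup_of_nonneg (norm_nonneg c) _).symm)

/-- The seminorms that define the topology of `C^∞(ℝ^d; ∧^m ℝ^d)`. -/
def seminormFamily (d m : ℕ) :
    SeminormFamily ℝ (SmoothForm d m) (TopologicalSpace.Compacts (E d) × ℕ) :=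
  fun p => seminorm d m p.1 p.2

/-- The locally convex topology of `C^∞(ℝ^d; ∧^m ℝ^d)`: uniform convergence of all derivatives
on compact sets. -/
instance : TopologicalSpace (SmoothForm d m) := (seminormFamily d m).moduleFilterBasis.topology

theorem withSeminorms (d m : ℕ) : WithSeminorms (seminormFamily d m) := ⟨rfl⟩

theorem le_seminorm (ω : SmoothForm d m) (K : TopologicalSpace.Compacts (E d)) (i : ℕ) {x : E d}
    (hx : x ∈ K) : ‖iteratedFDeriv ℝ i ω x‖ ≤ seminormFamily d m (K, i) ω :=
  le_ciSup (ω.bddAbove_iteratedFDeriv K i) (⟨x, hx⟩ : K)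

theorem seminorm_le (ω : SmoothForm d m) (K : TopologicalSpace.Compacts (E d)) (i : ℕ) {c : ℝ}
    (hc : 0 ≤ c) (h : ∀ x ∈ K, ‖iteratedFDeriv ℝ i ω x‖ ≤ c) :
    seminormFamily d m (K, i) ω ≤ c :=
  Real.iSup_le (fun x => h x x.2) hc

/-- The exterior derivative, as a linear map. -/
def dLin (d m : ℕ) : SmoothForm d m →ₗ[ℝ] SmoothForm d (m + 1) where
  toFun ω := ⟨extDeriv ω, by
    have h : ContDiff ℝ (⊤ : ℕ∞) (fderiv ℝ (ω : E d → Covector d m)) :=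
      ω.contDiff.fderiv_right (by simp)
    exact (ContinuousAlternatingMap.alternatizeUncurryFinCLM ℝ (E d) ℝ).contDiff.comp h⟩
  map_add' ω η := by
    apply Subtype.ext
    funext x
    exact extDeriv_add (ω.contDiff.differentiable (by simp) x)
      (η.contDiff.differentiable (by simp) x)
  map_smul' c ω := by
    apply Subtype.ext
    funext x
    exact extDeriv_smul c (ω : E d → Covector d m)

set_option maxSynthPendingDepth 4 in
/-- The exterior derivative `d : C^∞(ℝ^d; ∧^m ℝ^d) → C^∞(ℝ^d; ∧^{m+1} ℝ^d)`. -/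
def extD (d m : ℕ) : SmoothForm d m →L[ℝ] SmoothForm d (m + 1) where
  toLinearMap := dLin d m
  cont := by
    refine (withSeminorms d m).continuous_of_isBounded (withSeminorms d (m + 1)) _ ?_
    rintro ⟨K, i⟩
    refine ⟨{(K, i + 1)}, ⟨‖ContinuousAlternatingMap.alternatizeUncurryFinCLM (n := m) ℝ (E d) ℝ‖,
      norm_nonneg _⟩, fun ω => ?_⟩
    rw [Finset.sup_singleton]
    change seminormFamily d (m + 1) (K, i) (dLin d m ω) ≤ _ * seminormFamily d m (K, i + 1) ω
    refine seminorm_le _ _ _ (mul_nonneg (norm_nonneg _) (apply_nonneg _ _)) fun x hx => ?_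
    have hf : ContDiff ℝ i (fderiv ℝ (ω : E d → Covector d m)) :=
      ω.contDiff.fderiv_right (by exact_mod_cast le_top)
    have h1 := ContinuousLinearMap.norm_iteratedFDeriv_comp_left
      (ContinuousAlternatingMap.alternatizeUncurryFinCLM (n := m) ℝ (E d) ℝ)
      (hf.contDiffAt (x := x)) le_rfl
    have h2 := le_seminorm ω K (i + 1) hx
    rw [← norm_iteratedFDeriv_fderiv] at h2
    exact h1.trans (mul_le_mul_of_nonneg_left h2 (norm_nonneg _))

/-- `‖ω‖_∞ ≤ 1`. -/
def SupNormLeOne (ω : SmoothForm d m) : Prop := ∀ x, ‖ω x‖ ≤ 1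

end SmoothForm

/-! ### Currents -/

/-- Compactly supported `m`-currents in `ℝ^d`: the continuous linear functionals on
`C^∞(ℝ^d; ∧^m ℝ^d)`. -/
abbrev Current (d m : ℕ) : Type := SmoothForm d m →L[ℝ] ℝ

namespace Current

/-- `spt T ⊆ K`, for a compact set `K`. As `spt T` is the smallest compact set such that `T`
vanishes on all forms supported in its complement, `spt T ⊆ K` means that `T` vanishes on all forms
supported in the complement of `K`. -/
def SupportedIn (T : Current d m) (K : Set (E d)) : Prop :=
  ∀ ω : SmoothForm d m, tsupport (ω : E d → Covector d m) ⊆ Kᶜ → T ω = 0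

/-- The mass `M(T) = sup {T(ω) : ‖ω‖_∞ ≤ 1}`. -/
def mass (T : Current d m) : ℝ≥0∞ :=
  ⨆ (ω : SmoothForm d m) (_ : ω.SupNormLeOne), ENNReal.ofReal (T ω)

/-- The boundary `∂T(ω) = T(dω)`. -/
def boundary (T : Current d (m + 1)) : Current d m := T.comp (SmoothForm.extD d m)

/-- The normal mass: `N(T) = M(T) + M(∂T)` in dimension `m ≥ 1`, and `N(T) = M(T)` if `m = 0`. -/
def normalMass : {m : ℕ} → Current d m → ℝ≥0∞
  | 0, T => T.mass
  | _ + 1, T => T.mass + T.boundary.mass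

/-- Normal currents. -/
def IsNormal (T : Current d m) : Prop := T.normalMass < ⊤

/-- The flat norm `F(T) = sup {T(ω) : ‖ω‖_∞ ≤ 1, ‖dω‖_∞ ≤ 1}`. It is used for flat currents only
(in particular for normal ones); for these it is the limit of the flat norms of the approximating
normal currents, see `FlatApprox.tendsto_flatNorm` below. -/
def flatNorm (T : Current d m) : ℝ≥0∞ :=
  ⨆ (ω : SmoothForm d m) (_ : ω.SupNormLeOne ∧ (SmoothForm.extD d m ω).SupNormLeOne),
    ENNReal.ofReal (T ω)

/-- `S` is a sequence of normal currents that is Cauchy in flat norm, converges weakly to `T`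
(against all compactly supported smooth forms), and whose supports lie in a common compact set. -/
structure FlatApprox (S : ℕ → Current d m) (T : Current d m) : Prop where
  normal : ∀ n, (S n).IsNormal
  cauchy : ∀ ε : ℝ≥0∞, 0 < ε → ∃ n₀, ∀ n ≥ n₀, ∀ k ≥ n₀, flatNorm (S n - S k) ≤ ε
  weak : ∀ ω : SmoothForm d m, HasCompactSupport (ω : E d → Covector d m) →
    Tendsto (fun n => S n ω) atTop (𝓝 (T ω))
  support : ∃ K : Set (E d), IsCompact K ∧ ∀ n, (S n).SupportedIn K

/-- Flat currents. -/
def IsFlat (T : Current d m) : Prop := ∃ S : ℕ → Current d m, FlatApprox S T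

theorem le_flatNorm (T : Current d m) (ω : SmoothForm d m) (h : ω.SupNormLeOne)
    (h' : (SmoothForm.extD d m ω).SupNormLeOne) : ENNReal.ofReal (T ω) ≤ flatNorm T :=
  le_iSup₂_of_le ω ⟨h, h'⟩ le_rfl

theorem flatNorm_add_le (T T' : Current d m) : flatNorm (T + T') ≤ flatNorm T + flatNorm T' :=
  iSup₂_le fun ω hω => ENNReal.ofReal_add_le.trans
    (add_le_add (le_flatNorm T ω hω.1 hω.2) (le_flatNorm T' ω hω.1 hω.2))

theorem flatNorm_neg (T : Current d m) : flatNorm (-T) = flatNorm T := by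
  have key : ∀ T : Current d m, flatNorm (-T) ≤ flatNorm T := by
    refine fun T => iSup₂_le fun ω hω => ?_
    have h := le_flatNorm T ((-1 : ℝ) • ω)
      (fun x => by rw [SmoothForm.smul_apply, norm_smul]; simpa using hω.1 x)
      (fun x => by rw [map_smul, SmoothForm.smul_apply, norm_smul]; simpa using hω.2 x)
    rw [map_smul] at h
    simpa using h
  exact (key T).antisymm (by simpa using key (-T))

theorem flatNorm_lt_top {T : Current d m} (hT : T.IsNormal) : flatNorm T < ⊤ := by
  have h1 : flatNorm T ≤ T.mass := iSup₂_le fun ω hω => le_iSup₂_of_le ω hω.1 le_rfl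
  refine (h1.trans ?_).trans_lt hT
  cases m with
  | zero => exact le_rfl
  | succ m => exact le_self_add

/-- In the definition of flat currents, the convergence holds against all smooth forms. -/
theorem FlatApprox.tendsto_apply {S : ℕ → Current d m} {T : Current d m} (h : FlatApprox S T)
    (ω : SmoothForm d m) : Tendsto (fun n => S n ω) atTop (𝓝 (T ω)) := by
  obtain ⟨K, hK, hS⟩ := h.support
  obtain ⟨s, C, -, hC⟩ := Seminorm.bound_of_continuous (SmoothForm.withSeminorms d m)
    ((normSeminorm ℝ ℝ).comp T.toLinearMap) (continuous_norm.comp T.continuous)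
  have hL : IsCompact (K ∪ ⋃ p ∈ s, (p.1 : Set (E d))) :=
    hK.union (s.isCompact_biUnion fun p _ => p.1.isCompact)
  obtain ⟨R, hR0, hR⟩ := hL.isBounded.subset_ball_lt 0 0
  let χ : ContDiffBump (0 : E d) := ⟨R, R + 1, hR0, by linarith⟩
  let ω' : SmoothForm d m := ⟨fun x => χ x • ω x, by
    have h1 : ContDiff ℝ (⊤ : ℕ∞) (χ : E d → ℝ) := χ.contDiff
    exact h1.smul ω.contDiff⟩
  have hzero : ∀ x ∈ Metric.ball (0 : E d) R, (ω - ω' : SmoothForm d m) x = 0 := by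
    intro x hx
    change ω x - χ x • ω x = 0
    rw [χ.one_of_mem_closedBall (Metric.ball_subset_closedBall hx), one_smul, sub_self]
  have hSz : ∀ n, S n ω = S n ω' := by
    intro n
    rw [← sub_eq_zero, ← map_sub]
    refine hS n _ fun x hx hxK => ?_
    have hb := hR (Or.inl hxK)
    refine (mem_closure_iff.1 hx _ Metric.isOpen_ball hb).elim ?_
    rintro y ⟨hy, hy'⟩
    exact hy' (hzero y hy)
  have hTz : T ω = T ω' := by
    rw [← sub_eq_zero, ← map_sub, ← norm_le_zero_iff]
    refine (hC (ω - ω')).trans (le_of_eq ?_)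
    have : s.sup (SmoothForm.seminormFamily d m) (ω - ω') ≤ 0 := by
      refine Seminorm.finset_sup_apply_le le_rfl fun p hp => ?_
      refine SmoothForm.seminorm_le _ p.1 p.2 le_rfl fun x hx => ?_
      have hb : x ∈ Metric.ball (0 : E d) R := hR (Or.inr (mem_biUnion hp hx))
      have he : ((ω - ω' : SmoothForm d m) : E d → Covector d m) =ᶠ[𝓝 x] 0 :=
        eventually_of_mem (Metric.isOpen_ball.mem_nhds hb) hzero
      rw [he.iteratedFDeriv ℝ p.2 |>.eq_of_nhds]
      simp
    have h0 : s.sup (SmoothForm.seminormFamily d m) (ω - ω') = 0 :=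
      le_antisymm this (apply_nonneg _ _)
    rw [_root_.smul_apply, h0, smul_zero]
  rw [hTz]
  simp only [hSz]
  exact h.weak ω' χ.hasCompactSupport.smul_right

/-- The flat norm of a flat current `T` is the limit of the flat norms of the terms of any sequence
of normal currents as in the definition of a flat current. -/
theorem FlatApprox.tendsto_flatNorm {S : ℕ → Current d m} {T : Current d m}
    (h : FlatApprox S T) : Tendsto (fun n => flatNorm (S n)) atTop (𝓝 (flatNorm T)) := by
  have h1 : ∀ ε : ℝ≥0∞, 0 < ε → ∃ n₀, ∀ n ≥ n₀, flatNorm (S n - T) ≤ ε := by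
    intro ε hε
    obtain ⟨n₀, hn₀⟩ := h.cauchy ε hε
    refine ⟨n₀, fun n hn => iSup₂_le fun ω hω => ?_⟩
    have ht : Tendsto (fun k => ENNReal.ofReal ((S n - S k) ω)) atTop
        (𝓝 (ENNReal.ofReal ((S n - T) ω))) :=
      ENNReal.tendsto_ofReal (tendsto_const_nhds.sub (h.tendsto_apply ω))
    exact le_of_tendsto ht ((eventually_ge_atTop n₀).mono fun k hk =>
      (le_flatNorm _ ω hω.1 hω.2).trans (hn₀ n hn k hk))
  have h2 : ∀ n, flatNorm T ≤ flatNorm (S n) + flatNorm (S n - T) := fun n => by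
    have := flatNorm_add_le (S n) (-(S n - T))
    rwa [flatNorm_neg, neg_sub, add_sub_cancel] at this
  have h3 : ∀ n, flatNorm (S n) ≤ flatNorm T + flatNorm (S n - T) := fun n => by
    have := flatNorm_add_le T (S n - T)
    rwa [add_sub_cancel] at this
  have hfin : flatNorm T ≠ ⊤ := by
    obtain ⟨n₀, hn₀⟩ := h1 1 one_pos
    exact ((h2 n₀).trans_lt (ENNReal.add_lt_top.2
      ⟨flatNorm_lt_top (h.normal n₀), (hn₀ n₀ le_rfl).trans_lt ENNReal.one_lt_top⟩)).ne
  rw [ENNReal.tendsto_nhds hfin]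
  intro ε hε
  obtain ⟨n₀, hn₀⟩ := h1 ε hε
  filter_upwards [eventually_ge_atTop n₀] with n hn
  exact ⟨tsub_le_iff_right.2 ((h2 n).trans (by gcongr; exact hn₀ n hn)),
    (h3 n).trans (by gcongr; exact hn₀ n hn)⟩

/-! ### Fractional currents -/

/-- `(T_k)` is an `α`-fractional decomposition of `T`: the `T_k` are normal currents supported in a
common compact set, `∑ N(T_k)^(1-α) F(T_k)^α < ∞`, and `T = ∑ T_k` in flat norm. -/
structure IsFractionalDecomposition (α : ℝ) (T : Current d m) (Tk : ℕ → Current d m) : Prop where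
  normal : ∀ k, (Tk k).IsNormal
  support : ∃ K : Set (E d), IsCompact K ∧ ∀ k, (Tk k).SupportedIn K
  sum_lt_top : ∑' k, (Tk k).normalMass ^ (1 - α) * (Tk k).flatNorm ^ α < ⊤
  hasSum : Tendsto (fun n => flatNorm (T - ∑ k ∈ Finset.range n, Tk k)) atTop (𝓝 0)

/-- `T` is an `α`-fractional current (`0 ≤ α ≤ 1`). -/
def IsFractional (α : ℝ) (T : Current d m) : Prop :=
  T.IsFlat ∧ ∃ Tk : ℕ → Current d m, IsFractionalDecomposition α T Tk

end Current

/-! ### The current of integration over a bounded set -/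

/-- The standard basis `(e₁, …, e_d)` of `ℝ^d`. -/
def stdFrame (d : ℕ) : Fin d → E d := fun i => EuclideanSpace.basisFun (Fin d) ℝ i

theorem integrableOn_form {U : Set (E d)} (hU : Bornology.IsBounded U) (ω : SmoothForm d m)
    (v : Fin m → E d) : IntegrableOn (fun x => ω x v) U := by
  have hc : Continuous fun x : E d => ω x v :=
    (ContinuousAlternatingMap.apply ℝ (E d) ℝ v).continuous.comp ω.contDiff.continuous
  exact (hc.continuousOn.integrableOn_compact hU.isCompact_closure).mono_set subset_closure

/-- The `d`-current `⟦U⟧`, for a bounded set `U ⊆ ℝ^d`: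
`⟦U⟧(ω) = ∫_U ⟨ω(x), e₁ ∧ … ∧ e_d⟩ dx`. -/
def integrationCurrent (U : Set (E d)) (hU : Bornology.IsBounded U) : Current d d where
  toFun ω := ∫ x in U, ω x (stdFrame d)
  map_add' ω η :=
    integral_add (integrableOn_form hU ω (stdFrame d)) (integrableOn_form hU η (stdFrame d))
  map_smul' c ω := integral_const_mul c fun x => ω x (stdFrame d)
  cont := by
    let L : SmoothForm d d →ₗ[ℝ] ℝ :=
      { toFun := fun ω => ∫ x in U, ω x (stdFrame d)
        map_add' := fun ω η => integral_add (integrableOn_form hU ω (stdFrame d))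
          (integrableOn_form hU η (stdFrame d))
        map_smul' := fun c ω => integral_const_mul c fun x => ω x (stdFrame d) }
    change Continuous L
    refine (SmoothForm.withSeminorms d d).continuous_of_isBounded
      (norm_withSeminorms ℝ ℝ) _ ?_
    intro _
    refine ⟨{(⟨closure U, hU.isCompact_closure⟩, 0)},
      ⟨volume.real U, measureReal_nonneg⟩, fun ω => ?_⟩
    rw [Finset.sup_singleton]
    change ‖∫ x in U, ω x (stdFrame d)‖ ≤ volume.real U * _
    rw [mul_comm]
    refine norm_setIntegral_le_of_norm_le_const hU.measure_lt_top fun x hx => ?_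
    have h := SmoothForm.le_seminorm ω ⟨closure U, hU.isCompact_closure⟩ 0
      (x := x) (subset_closure hx)
    rw [norm_iteratedFDeriv_zero] at h
    refine le_trans ?_ h
    refine ((ω x).le_opNorm _).trans ?_
    simp [stdFrame]

/-! ### Dyadic cubes and summable sets -/

/-- The dyadic `k`-cube `∏ᵢ [ℓᵢ / 2^k, (ℓᵢ + 1) / 2^k]`. -/
def dyadicCube (k : ℕ) (l : Fin d → ℤ) : Set (E d) :=
  {x | ∀ i, (l i : ℝ) / 2 ^ k ≤ x i ∧ x i ≤ ((l i : ℝ) + 1) / 2 ^ k}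

/-- `N_A(k)`: the number of `k`-cubes that meet the bounded set `A`. -/
def boxCount (A : Set (E d)) (k : ℕ) : ℕ := {l : Fin d → ℤ | (dyadicCube k l ∩ A).Nonempty}.ncard

/-- A bounded set `A` is `s`-summable if `∑ N_A(k) 2^(-k s) < ∞`. -/
def IsBoxSummable (A : Set (E d)) (s : ℝ) : Prop :=
  Summable fun k : ℕ => (boxCount A k : ℝ) * (2 : ℝ) ^ (-(k : ℝ) * s)

end FractionalCurrents

end

/-!
The current `⟦U⟧` is decomposed along a Whitney-type dyadic exhaustion of `U`. Let `innerCells U k`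
be the union of the half-open dyadic `k`-cells whose closed cubes lie in `U`. These sets increase
with `k`, and `⟦U⟧` is the sum of the currents `layerCurrent` of integration over `innerCells U 0`
and over the differences `innerCells U (k + 1) \ innerCells U k`.

A cell of the difference has a parent cube that meets `U` but is not contained in it. The cube being
connected, it meets the frontier, so the difference consists of at most `2^d N(k)` cells of side
`2^(-(k+1))`, where `N` is the box count of the frontier (`exists_finset_innerCells_succ_sdiff_eq`).
The mass of a union of `k`-cells is at most their number times `2^(-kd)`, and by the divergence
theorem on boxes (`norm_integral_extD_box_le`) its boundary has mass at most `2d 2^(-k(d-1))` times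
their number. Interpolating these two bounds
(`normalMass_rpow_mul_flatNorm_rpow_dyadicCells_le`), the `k`-th term of the fractional series is at
most a constant times `N(k) 2^(-k(d-1+α))`, which is summable by hypothesis.

Finally `U \ innerCells U k` is covered by the `k`-cells that meet the frontier, whose total volume
`N(k) 2^(-kd)` tends to zero because `d - 1 + α ≤ d`. As the flat norm is at most the mass, the
partial sums converge to `⟦U⟧` in flat norm, and they also show that `⟦U⟧` is flat.
-/

namespace FractionalCurrents

variable {d m : ℕ}

theorem norm_stdFrame (i : Fin d) : ‖stdFrame d i‖ = 1 := by
  simp [stdFrame]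

theorem SmoothForm.SupNormLeOne.norm_apply_stdFrame_le {ω : SmoothForm d m} (hω : ω.SupNormLeOne)
    (x : E d) (j : Fin m → Fin d) : ‖ω x (fun i => stdFrame d (j i))‖ ≤ 1 := by
  refine ((ω x).le_opNorm _).trans ?_
  simpa [norm_stdFrame] using hω x

/-! ### Currents of integration -/

namespace Current

theorem flatNorm_le_mass (T : Current d m) : T.flatNorm ≤ T.mass :=
  iSup₂_le fun ω hω => le_iSup₂_of_le ω hω.1 le_rfl

end Current

theorem integrationCurrent_apply (A : Set (E d)) (hA : Bornology.IsBounded A)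
    (ω : SmoothForm d d) : integrationCurrent A hA ω = ∫ x in A, ω x (stdFrame d) := rfl

theorem mass_integrationCurrent_le (A : Set (E d)) (hA : Bornology.IsBounded A) :
    (integrationCurrent A hA).mass ≤ volume A := by
  refine iSup₂_le fun ω hω => ?_
  refine ENNReal.ofReal_le_of_le_toReal ?_
  rw [integrationCurrent_apply]
  refine (Real.le_norm_self _).trans ?_
  simpa [Measure.real] using norm_setIntegral_le_of_norm_le_const (C := 1) hA.measure_lt_top
    fun x _ => hω.norm_apply_stdFrame_le x id

theorem integrationCurrent_supportedIn {A K : Set (E d)} (hA : Bornology.IsBounded A)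
    (hAK : A ⊆ K) : (integrationCurrent A hA).SupportedIn K := by
  intro ω hω
  refine setIntegral_eq_zero_of_forall_eq_zero fun x hx => ?_
  have h : ω x = 0 := image_eq_zero_of_notMem_tsupport fun h => hω h (hAK hx)
  simp [h]

theorem integrationCurrent_sub {A B : Set (E d)} (hA : Bornology.IsBounded A)
    (hB : Bornology.IsBounded B) (hBA : B ⊆ A) (hBm : MeasurableSet B) :
    integrationCurrent A hA - integrationCurrent B hB
      = integrationCurrent (A \ B) (hA.subset sdiff_subset) := by
  ext ω
  exact (setIntegral_sdiff hBm (integrableOn_form hA ω (stdFrame d)) hBA).symm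

/-! ### The boundary of a box -/

theorem volume_real_Icc_of_sub_eq {n : ℕ} {a b : Fin n → ℝ} {δ : ℝ} (hδ : 0 ≤ δ)
    (hab : ∀ i, b i - a i = δ) : volume.real (Icc a b) = δ ^ n := by
  rw [Measure.real, Real.volume_Icc_pi_toReal fun i => by linarith [hab i]]
  simp [hab]

/-- Stokes' theorem for a cube of side `δ` in `ℝ^(n+1)`, as a bound: the integral of `dω` is a sum
over the `2 (n + 1)` faces, each contributing at most its `n`-volume `δ ^ n`. -/
theorem norm_integral_extD_box_le {n : ℕ} (ω : SmoothForm (n + 1) n) (hω : ω.SupNormLeOne)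
    {a b : Fin (n + 1) → ℝ} {δ : ℝ} (hδ : 0 ≤ δ) (hab : ∀ i, b i - a i = δ) :
    ‖∫ y in Icc a b, SmoothForm.extD (n + 1) n ω (WithLp.toLp 2 y) (stdFrame (n + 1))‖
      ≤ 2 * (n + 1) * δ ^ n := by
  let L : (Fin (n + 1) → ℝ) ≃L[ℝ] E (n + 1) := (EuclideanSpace.equiv (Fin (n + 1)) ℝ).symm
  let g : Fin (n + 1) → E (n + 1) → ℝ := fun i x => ω x (i.removeNth (stdFrame (n + 1)))
  have hg : ∀ i, ContDiff ℝ (⊤ : ℕ∞) (g i) := fun i =>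
    (ContinuousAlternatingMap.apply ℝ (E (n + 1)) ℝ
      (i.removeNth (stdFrame (n + 1)))).contDiff.comp ω.contDiff
  have hgb : ∀ i x, ‖g i x‖ ≤ 1 := fun i x => hω.norm_apply_stdFrame_le x i.succAbove
  -- The divergence of the vector field `(f i)` is `dω` evaluated at the standard frame.
  let f : Fin (n + 1) → (Fin (n + 1) → ℝ) → ℝ := fun i y => (-1) ^ i.val * g i (L y)
  let f' : Fin (n + 1) → (Fin (n + 1) → ℝ) → (Fin (n + 1) → ℝ) →L[ℝ] ℝ :=
    fun i y => (-1 : ℝ) ^ i.val •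
      (fderiv ℝ (g i) (L y)).comp (L : (Fin (n + 1) → ℝ) →L[ℝ] E (n + 1))
  have hf : ∀ i y, HasFDerivAt (f i) (f' i y) y := fun i y =>
    ((((hg i).differentiable (by simp)) (L y)).hasFDerivAt.comp y L.hasFDerivAt).const_mul _
  have hext : ∀ y, SmoothForm.extD (n + 1) n ω (WithLp.toLp 2 y) (stdFrame (n + 1))
      = ∑ i, f' i y (Pi.single i 1) := by
    intro y
    refine (extDeriv_apply (ω.contDiff.differentiable (by simp) _) _).trans ?_
    refine Finset.sum_congr rfl fun i _ => ?_
    have : stdFrame (n + 1) i = L (Pi.single i 1) := by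
      simp [stdFrame, L]
    rw [this]
    simp [f', g, L]
  have hcont : Continuous fun y : Fin (n + 1) → ℝ =>
      SmoothForm.extD (n + 1) n ω (WithLp.toLp 2 y) (stdFrame (n + 1)) :=
    (ContinuousAlternatingMap.apply ℝ (E (n + 1)) ℝ _).continuous.comp
      ((SmoothForm.extD (n + 1) n ω).contDiff.continuous.comp L.continuous)
  have hdiv := integral_divergence_of_hasFDerivAt_off_countable' a b
    (fun i => by linarith [hab i]) f f' ∅ countable_empty
    (fun i y _ => (hf i y).continuousAt.continuousWithinAt) (fun y _ i => hf i y)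
    (by
      simp only [← hext]
      exact hcont.continuousOn.integrableOn_compact isCompact_Icc)
  simp only [hext]
  rw [hdiv]
  have hface : ∀ (i : Fin (n + 1)) (c : ℝ),
      ‖∫ y in Icc (a ∘ i.succAbove) (b ∘ i.succAbove), f i (i.insertNth c y)‖ ≤ δ ^ n := by
    intro i c
    rw [← volume_real_Icc_of_sub_eq (a := a ∘ i.succAbove) (b := b ∘ i.succAbove) hδ
      fun j => hab _, ← one_mul (volume.real _)]
    refine norm_setIntegral_le_of_norm_le_const isCompact_Icc.measure_lt_top fun y _ => ?_
    simpa [f] using hgb i _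
  calc _ ≤ ∑ i : Fin (n + 1), (δ ^ n + δ ^ n) :=
        norm_sum_le_of_le _ fun i _ => (norm_sub_le _ _).trans (add_le_add (hface i _) (hface i _))
    _ = 2 * (n + 1) * δ ^ n := by
        simp only [Finset.sum_const, Finset.card_univ, Fintype.card_fin, nsmul_eq_mul]
        push_cast
        ring

/-! ### Dyadic cells -/

/-- The index of the half-open dyadic `k`-cell `∏ᵢ [ℓᵢ / 2^k, (ℓᵢ + 1) / 2^k)` that contains `x`.
The fibres of this map are the cells; unlike the closed cubes, they partition `ℝ^d`. -/
noncomputable def dyadicIndex (k : ℕ) (x : E d) : Fin d → ℤ := fun i => ⌊2 ^ k * x i⌋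

theorem measurable_dyadicIndex (k : ℕ) : Measurable (dyadicIndex (d := d) k) := by
  refine measurable_pi_lambda _ fun i => Int.measurable_floor.comp ?_
  exact ((EuclideanSpace.proj (𝕜 := ℝ) i).continuous.measurable).const_mul _

theorem measurableSet_dyadicIndex_preimage (k : ℕ) (s : Set (Fin d → ℤ)) :
    MeasurableSet (dyadicIndex k ⁻¹' s) :=
  measurable_dyadicIndex k s.to_countable.measurableSet

theorem mem_dyadicCube_dyadicIndex (k : ℕ) (x : E d) : x ∈ dyadicCube k (dyadicIndex k x) := by
  intro i
  have h : (0 : ℝ) < 2 ^ k := by positivity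
  rw [div_le_iff₀ h, le_div_iff₀ h, mul_comm (x i)]
  exact ⟨Int.floor_le _, (Int.lt_floor_add_one _).le⟩

theorem dyadicIndex_preimage_singleton (k : ℕ) (l : Fin d → ℤ) :
    dyadicIndex k ⁻¹' {l} = WithLp.ofLp ⁻¹'
      (Set.pi univ fun i => Ico ((l i : ℝ) / 2 ^ k) (((l i : ℝ) + 1) / 2 ^ k)) := by
  ext x
  have h : (0 : ℝ) < 2 ^ k := by positivity
  simp only [mem_preimage, mem_singleton_iff, dyadicIndex, funext_iff, mem_univ_pi, mem_Ico,
    Int.floor_eq_iff, div_le_iff₀ h, lt_div_iff₀ h, mul_comm _ ((2 : ℝ) ^ k)]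

theorem setIntegral_dyadicIndex_preimage_singleton (k : ℕ) (l : Fin d → ℤ) (f : E d → ℝ) :
    ∫ x in dyadicIndex k ⁻¹' {l}, f x
      = ∫ y in Icc (fun i => (l i : ℝ) / 2 ^ k) (fun i => ((l i : ℝ) + 1) / 2 ^ k),
        f (WithLp.toLp 2 y) := by
  rw [dyadicIndex_preimage_singleton]
  refine ((PiLp.volume_preserving_ofLp (Fin d)).setIntegral_preimage_emb
    (MeasurableEquiv.toLp 2 (Fin d → ℝ)).symm.measurableEmbedding
    (fun y => f (WithLp.toLp 2 y)) _).trans ?_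
  exact setIntegral_congr_set Measure.univ_pi_Ico_ae_eq_Icc

theorem div_two_pow_sub (k : ℕ) (c : ℝ) : (c + 1) / 2 ^ k - c / 2 ^ k = ((2 : ℝ) ^ k)⁻¹ := by
  rw [← sub_div, add_sub_cancel_left, one_div]

theorem volume_dyadicIndex_preimage_singleton (k : ℕ) (l : Fin d → ℤ) :
    volume (dyadicIndex k ⁻¹' {l}) = ENNReal.ofReal (((2 : ℝ) ^ k)⁻¹ ^ d) := by
  rw [dyadicIndex_preimage_singleton, (PiLp.volume_preserving_ofLp (Fin d)).measure_preimage
    (MeasurableSet.univ_pi fun i => measurableSet_Ico).nullMeasurableSet, Real.volume_pi_Ico]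
  simp only [div_two_pow_sub]
  rw [ENNReal.ofReal_pow (by positivity)]
  simp

theorem volume_dyadicIndex_preimage (k : ℕ) (S : Finset (Fin d → ℤ)) :
    volume (dyadicIndex k ⁻¹' (S : Set (Fin d → ℤ)))
      = ENNReal.ofReal (S.card * ((2 : ℝ) ^ k)⁻¹ ^ d) := by
  rw [← sum_measure_preimage_singleton S
    fun l _ => measurableSet_dyadicIndex_preimage k {l}]
  simp only [volume_dyadicIndex_preimage_singleton]
  rw [Finset.sum_const, nsmul_eq_mul, ENNReal.ofReal_mul (by positivity), ENNReal.ofReal_natCast]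

/-- The perimeter bound ignores that faces shared by two of the cells cancel. -/
theorem mass_boundary_dyadicCells_le {n : ℕ} (k : ℕ) (S : Finset (Fin (n + 1) → ℤ))
    (hS : Bornology.IsBounded (dyadicIndex k ⁻¹' (S : Set (Fin (n + 1) → ℤ)))) :
    (integrationCurrent _ hS).boundary.mass
      ≤ ENNReal.ofReal (S.card * (2 * (n + 1) * ((2 : ℝ) ^ k)⁻¹ ^ n)) := by
  refine iSup₂_le fun ω hω => ENNReal.ofReal_le_ofReal ?_
  change ∫ x in dyadicIndex k ⁻¹' (S : Set (Fin (n + 1) → ℤ)),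
    SmoothForm.extD (n + 1) n ω x (stdFrame (n + 1)) ≤ _
  have hU : dyadicIndex k ⁻¹' (S : Set (Fin (n + 1) → ℤ)) = ⋃ l ∈ S, dyadicIndex k ⁻¹' {l} := by
    rw [← biUnion_preimage_singleton]
    rfl
  have hint := integrableOn_form hS (SmoothForm.extD (n + 1) n ω) (stdFrame (n + 1))
  rw [hU] at hint ⊢
  rw [integral_biUnion_finset S (fun l _ => measurableSet_dyadicIndex_preimage k {l})
    (fun l _ l' _ h => Disjoint.preimage _ (disjoint_singleton.2 h))
    (fun l hl => hint.mono_set (subset_biUnion_of_mem (u := fun l => dyadicIndex k ⁻¹' {l}) hl))]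
  rw [← nsmul_eq_mul]
  refine Finset.sum_le_card_nsmul _ _ _ fun l _ => ?_
  rw [setIntegral_dyadicIndex_preimage_singleton]
  exact (Real.le_norm_self _).trans (norm_integral_extD_box_le ω hω (by positivity)
    fun i => div_two_pow_sub k _)

/-- The exponent is written as a real number so that the bound also makes sense for `d = 0`, where
the normal mass is the mass and the power is `2 ^ k ≥ 1`. -/
theorem normalMass_dyadicCells_le (k : ℕ) (S : Finset (Fin d → ℤ))
    (hS : Bornology.IsBounded (dyadicIndex k ⁻¹' (S : Set (Fin d → ℤ)))) :
    (integrationCurrent _ hS).normalMass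
      ≤ ENNReal.ofReal (S.card * ((2 * d + 1) * (2 : ℝ) ^ (-(k : ℝ) * (d - 1)))) := by
  have hm := mass_integrationCurrent_le _ hS
  rw [volume_dyadicIndex_preimage] at hm
  cases d with
  | zero =>
    refine hm.trans (ENNReal.ofReal_le_ofReal ?_)
    gcongr
    simp only [pow_zero, CharP.cast_eq_zero, mul_zero, zero_add, one_mul]
    exact Real.one_le_rpow one_le_two (by simp)
  | succ n =>
    refine (add_le_add hm (mass_boundary_dyadicCells_le k S hS)).trans ?_
    rw [← ENNReal.ofReal_add (by positivity) (by positivity), ← mul_add]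
    refine ENNReal.ofReal_le_ofReal ?_
    have h : (2 : ℝ) ^ (-(k : ℝ) * ((n + 1 : ℕ) - 1)) = ((2 : ℝ) ^ k)⁻¹ ^ n := by
      rw [Nat.cast_succ, add_sub_cancel_right, Real.rpow_mul two_pos.le, Real.rpow_neg two_pos.le,
        Real.rpow_natCast, Real.rpow_natCast]
    rw [h]
    have h1 : ((2 : ℝ) ^ k)⁻¹ ≤ 1 := inv_le_one_of_one_le₀ (one_le_pow₀ one_le_two)
    have h2 : ((2 : ℝ) ^ k)⁻¹ ^ (n + 1) ≤ ((2 : ℝ) ^ k)⁻¹ ^ n :=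
      pow_le_pow_of_le_one (by positivity) h1 n.le_succ
    gcongr
    push_cast
    linarith

/-! ### Interpolation between mass and normal mass -/

/-- For the current of a union of `N` dyadic `k`-cells, `N(T)^(1-α) F(T)^α` is at most a constant
times `N 2^(-k (d - 1 + α))`: interpolate between the bound `N 2^(-k (d - 1))` for the normal mass
and the bound `N 2^(-k d)` for the mass, which dominates the flat norm. -/
theorem normalMass_rpow_mul_flatNorm_rpow_dyadicCells_le {α : ℝ} (hα : α ∈ Icc (0 : ℝ) 1) (k : ℕ)
    (S : Finset (Fin d → ℤ))
    (hS : Bornology.IsBounded (dyadicIndex k ⁻¹' (S : Set (Fin d → ℤ)))) :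
    (integrationCurrent _ hS).normalMass ^ (1 - α) * (integrationCurrent _ hS).flatNorm ^ α
      ≤ ENNReal.ofReal (S.card * ((2 * d + 1) * (2 : ℝ) ^ (-(k : ℝ) * (d - 1 + α)))) := by
  have hN := normalMass_dyadicCells_le k S hS
  have hF := (Current.flatNorm_le_mass _).trans (mass_integrationCurrent_le _ hS)
  rw [volume_dyadicIndex_preimage] at hF
  have hα1 : 0 ≤ 1 - α := sub_nonneg.2 hα.2
  set c : ℝ := S.card * (2 * d + 1) with hc
  have hc0 : 0 ≤ c := by positivity
  have hY : ((2 : ℝ) ^ k)⁻¹ ^ d = (2 : ℝ) ^ (-(k : ℝ) * d) := by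
    rw [Real.rpow_mul two_pos.le, Real.rpow_neg two_pos.le, Real.rpow_natCast, Real.rpow_natCast]
  have hF' : (integrationCurrent _ hS).flatNorm ≤ ENNReal.ofReal (c * 2 ^ (-(k : ℝ) * d)) := by
    refine hF.trans (ENNReal.ofReal_le_ofReal ?_)
    rw [hY]
    gcongr
    rw [hc]
    exact le_mul_of_one_le_right (by positivity) (by linarith [(Nat.cast_nonneg d : (0 : ℝ) ≤ d)])
  rw [← mul_assoc, ← hc] at hN ⊢
  refine (mul_le_mul' (ENNReal.rpow_le_rpow hN hα1) (ENNReal.rpow_le_rpow hF' hα.1)).trans ?_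
  rw [ENNReal.ofReal_rpow_of_nonneg (by positivity) hα1,
    ENNReal.ofReal_rpow_of_nonneg (by positivity) hα.1, ← ENNReal.ofReal_mul (by positivity),
    Real.mul_rpow hc0 (by positivity), Real.mul_rpow hc0 (by positivity), mul_mul_mul_comm,
    ← Real.rpow_add' hc0 (by simp), ← Real.rpow_mul two_pos.le, ← Real.rpow_mul two_pos.le,
    ← Real.rpow_add two_pos, sub_add_cancel, Real.rpow_one]
  refine le_of_eq ?_
  congr 3
  ring

theorem isNormal_dyadicCells (k : ℕ) (S : Finset (Fin d → ℤ))
    (hS : Bornology.IsBounded (dyadicIndex k ⁻¹' (S : Set (Fin d → ℤ)))) :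
    (integrationCurrent _ hS).IsNormal :=
  (normalMass_dyadicCells_le k S hS).trans_lt ENNReal.ofReal_lt_top

/-! ### Dyadic cubes and the frontier -/

theorem finite_dyadicCube_inter_nonempty {A : Set (E d)} (hA : Bornology.IsBounded A) (k : ℕ) :
    {l : Fin d → ℤ | (dyadicCube k l ∩ A).Nonempty}.Finite := by
  obtain ⟨R, hR⟩ := hA.exists_norm_le
  -- The lower bound loses one because the right end `(l i + 1) / 2 ^ k` is only known to be `≥ -R`.
  refine (Set.finite_Icc (fun _ => ⌊-(2 ^ k * R)⌋ - 1) (fun _ => ⌈2 ^ k * R⌉)).subset ?_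
  rintro l ⟨x, hx, hxA⟩
  have h : (0 : ℝ) < 2 ^ k := by positivity
  have hxi : ∀ i, |2 ^ k * x i| ≤ 2 ^ k * R := fun i => by
    rw [abs_mul, abs_of_pos h]
    have := (PiLp.norm_apply_le x i).trans (hR x hxA)
    rw [Real.norm_eq_abs] at this
    gcongr
  have hl : ∀ i, (l i : ℝ) ≤ 2 ^ k * x i ∧ 2 ^ k * x i ≤ l i + 1 := fun i => by
    have := hx i
    rwa [div_le_iff₀ h, le_div_iff₀ h, mul_comm (x i)] at this
  refine ⟨fun i => ?_, fun i => ?_⟩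
  · have h1 := (abs_le.1 (hxi i)).1.trans (hl i).2
    have h2 : (⌊-(2 ^ k * R)⌋ : ℝ) ≤ l i + 1 := (Int.floor_le _).trans h1
    have h3 : ⌊-(2 ^ k * R)⌋ ≤ l i + 1 := by exact_mod_cast h2
    exact sub_le_iff_le_add.2 h3
  · have h1 : (l i : ℝ) ≤ ⌈2 ^ k * R⌉ := (hl i).1.trans ((abs_le.1 (hxi i)).2.trans (Int.le_ceil _))
    exact Int.cast_le.1 h1

theorem convex_dyadicCube (k : ℕ) (l : Fin d → ℤ) : Convex ℝ (dyadicCube k l) := by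
  intro x hx y hy a b ha hb hab i
  exact convex_Icc ((l i : ℝ) / 2 ^ k) (((l i : ℝ) + 1) / 2 ^ k) (hx i) (hy i) ha hb hab

theorem _root_.IsPreconnected.inter_frontier_nonempty {X : Type*} [TopologicalSpace X]
    {s t : Set X} (ht : IsPreconnected t) (h : (t ∩ s).Nonempty) (h' : (t ∩ sᶜ).Nonempty) :
    (t ∩ frontier s).Nonempty := by
  by_contra hne
  have hfr : ∀ x ∈ t, x ∉ frontier s := fun x hx hx' => hne ⟨x, hx, hx'⟩
  have hcov : ∀ x ∈ t, (x ∈ s → x ∈ interior s) ∧ (x ∉ s → x ∈ (closure s)ᶜ) := fun x hx =>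
    ⟨fun hxs => by_contra fun hi => hfr x hx ⟨subset_closure hxs, hi⟩,
      fun hxs hc => hfr x hx ⟨hc, fun hi => hxs (interior_subset hi)⟩⟩
  obtain ⟨x, hx, hxs⟩ := h
  obtain ⟨y, hy, hys⟩ := h'
  obtain ⟨z, -, hz, hz'⟩ := ht (interior s) (closure s)ᶜ isOpen_interior isClosed_closure.isOpen_compl
    (fun w hw => (em (w ∈ s)).imp (hcov w hw).1 (hcov w hw).2)
    ⟨x, hx, (hcov x hx).1 hxs⟩ ⟨y, hy, (hcov y hy).2 hys⟩
  exact hz' (interior_subset_closure hz)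

theorem dyadicCube_inter_frontier_nonempty {U : Set (E d)} {k : ℕ} {l : Fin d → ℤ}
    (h : (dyadicCube k l ∩ U).Nonempty) (h' : ¬ dyadicCube k l ⊆ U) :
    (dyadicCube k l ∩ frontier U).Nonempty :=
  (convex_dyadicCube k l).isPreconnected.inter_frontier_nonempty h (inter_compl_nonempty_iff.2 h')

theorem dyadicIndex_eq_succ_div_two (k : ℕ) (x : E d) :
    dyadicIndex k x = fun i => dyadicIndex (k + 1) x i / 2 := by
  funext i
  have h := Int.floor_div_natCast (2 ^ (k + 1) * x i) 2
  have h' : (2 : ℝ) ^ (k + 1) * x i / (2 : ℕ) = 2 ^ k * x i := by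
    push_cast
    ring
  rwa [h'] at h

theorem dyadicCube_succ_subset (k : ℕ) (l : Fin d → ℤ) :
    dyadicCube (k + 1) l ⊆ dyadicCube k fun i => l i / 2 := by
  intro x hx i
  have h : (0 : ℝ) < 2 ^ k := by positivity
  have h1 := hx i
  rw [div_le_iff₀ (by positivity), le_div_iff₀ (by positivity), pow_succ] at h1
  have h2 : (2 * (l i / 2 : ℤ) : ℝ) ≤ l i := by exact_mod_cast Int.mul_ediv_self_le two_ne_zero
  have h3 : (l i : ℝ) + 1 ≤ 2 * (l i / 2 : ℤ) + 2 := by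
    have : l i + 1 ≤ 2 * (l i / 2) + 2 := by omega
    exact_mod_cast this
  rw [div_le_iff₀ h, le_div_iff₀ h]
  constructor <;> linarith

/-- Each dyadic `k`-cube has `2^d` children, so a set of `(k + 1)`-cubes whose parents lie in `t`
has at most `2^d * #t` elements. -/
theorem card_le_of_mapsTo_parent (S t : Finset (Fin d → ℤ))
    (h : ∀ l ∈ S, (fun i => l i / 2) ∈ t) : S.card ≤ 2 ^ d * t.card := by
  classical
  refine Finset.card_le_mul_card_image_of_maps_to (f := fun l i => l i / 2) h _ fun p _ => ?_
  calc (S.filter fun l => (fun i => l i / 2) = p).card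
      ≤ (Fintype.piFinset fun i => ({2 * p i, 2 * p i + 1} : Finset ℤ)).card := by
        refine Finset.card_le_card fun l hl => ?_
        rw [Finset.mem_filter] at hl
        rw [Fintype.mem_piFinset]
        intro i
        have := congrFun hl.2 i
        simp only [Finset.mem_insert, Finset.mem_singleton]
        omega
    _ = ∏ i, ({2 * p i, 2 * p i + 1} : Finset ℤ).card := Fintype.card_piFinset _
    _ ≤ ∏ _i : Fin d, 2 := Finset.prod_le_prod' fun i _ => Finset.card_le_two
    _ = 2 ^ d := by simp

/-! ### The dyadic exhaustion of an open set -/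

/-- The union of the half-open dyadic `k`-cells whose closed cubes are contained in `U`. -/
noncomputable def innerCells (U : Set (E d)) (k : ℕ) : Set (E d) :=
  dyadicIndex k ⁻¹' {l | dyadicCube k l ⊆ U}

variable {U : Set (E d)}

theorem innerCells_subset (U : Set (E d)) (k : ℕ) : innerCells U k ⊆ U :=
  fun x hx => hx (mem_dyadicCube_dyadicIndex k x)

theorem measurableSet_innerCells (U : Set (E d)) (k : ℕ) : MeasurableSet (innerCells U k) :=
  measurableSet_dyadicIndex_preimage k _

theorem innerCells_subset_succ (U : Set (E d)) (k : ℕ) : innerCells U k ⊆ innerCells U (k + 1) := by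
  intro x hx
  change dyadicCube k _ ⊆ U at hx
  rw [dyadicIndex_eq_succ_div_two] at hx
  exact (dyadicCube_succ_subset k _).trans hx

theorem exists_finset_innerCells_eq (hU : Bornology.IsBounded U) (k : ℕ) :
    ∃ S : Finset (Fin d → ℤ), innerCells U k = dyadicIndex k ⁻¹' (S : Set (Fin d → ℤ)) := by
  classical
  have hfin := finite_dyadicCube_inter_nonempty hU k
  refine ⟨hfin.toFinset.filter fun l => dyadicCube k l ⊆ U, ?_⟩
  ext x
  simp only [innerCells, mem_preimage, mem_ofPred_eq, Finset.coe_filter, Finite.mem_toFinset]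
  exact ⟨fun h => ⟨⟨x, mem_dyadicCube_dyadicIndex k x, h (mem_dyadicCube_dyadicIndex k x)⟩, h⟩,
    fun h => h.2⟩

/-- The cells added at level `k + 1` have parents that meet `U` without being contained in it, hence
meet the frontier of `U`; this bounds their number. -/
theorem exists_finset_innerCells_succ_sdiff_eq (hU : Bornology.IsBounded U) (k : ℕ) :
    ∃ S : Finset (Fin d → ℤ), S.card ≤ 2 ^ d * boxCount (frontier U) k ∧
      innerCells U (k + 1) \ innerCells U k = dyadicIndex (k + 1) ⁻¹' (S : Set (Fin d → ℤ)) := by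
  classical
  have hfin := finite_dyadicCube_inter_nonempty hU (k + 1)
  have hfin' := finite_dyadicCube_inter_nonempty (hU.closure.subset frontier_subset_closure) k
  refine ⟨hfin.toFinset.filter fun l =>
    dyadicCube (k + 1) l ⊆ U ∧ ¬ dyadicCube k (fun i => l i / 2) ⊆ U, ?_, ?_⟩
  · rw [boxCount, ncard_eq_toFinset_card _ hfin']
    refine card_le_of_mapsTo_parent _ _ fun l hl => ?_
    simp only [Finset.mem_filter, Finite.mem_toFinset, mem_ofPred_eq] at hl ⊢
    exact dyadicCube_inter_frontier_nonempty
      (hl.1.mono (inter_subset_inter_left _ (dyadicCube_succ_subset k l))) hl.2.2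
  · ext x
    simp only [innerCells, Set.mem_sdiff, mem_preimage, mem_ofPred_eq, Finset.coe_filter,
      Finite.mem_toFinset, dyadicIndex_eq_succ_div_two k x]
    exact ⟨fun h => ⟨⟨x, mem_dyadicCube_dyadicIndex _ x, h.1 (mem_dyadicCube_dyadicIndex _ x)⟩, h⟩,
      fun h => h.2⟩

theorem volume_sdiff_innerCells_le (hU : Bornology.IsBounded U) (k : ℕ) :
    volume (U \ innerCells U k)
      ≤ ENNReal.ofReal (boxCount (frontier U) k * (2 : ℝ) ^ (-(k : ℝ) * d)) := by
  have hfin := finite_dyadicCube_inter_nonempty (hU.closure.subset frontier_subset_closure) k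
  have hsub : U \ innerCells U k
      ⊆ dyadicIndex k ⁻¹' (hfin.toFinset : Set (Fin d → ℤ)) := by
    intro x hx
    rw [Finite.coe_toFinset]
    exact dyadicCube_inter_frontier_nonempty ⟨x, mem_dyadicCube_dyadicIndex k x, hx.1⟩ hx.2
  refine (measure_mono hsub).trans_eq ?_
  rw [volume_dyadicIndex_preimage, boxCount, ncard_eq_toFinset_card _ hfin,
    Real.rpow_mul two_pos.le, Real.rpow_neg two_pos.le, Real.rpow_natCast, Real.rpow_natCast]

/-- The terms of the summable series tend to zero, and for `s ≤ d` they dominate the volume of the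
cubes that meet the frontier. -/
theorem tendsto_volume_sdiff_innerCells (hU : Bornology.IsBounded U) {s : ℝ} (hs : s ≤ d)
    (h : IsBoxSummable (frontier U) s) :
    Tendsto (fun k => volume (U \ innerCells U k)) atTop (𝓝 0) := by
  have h0 := ENNReal.tendsto_ofReal h.tendsto_atTop_zero
  rw [ENNReal.ofReal_zero] at h0
  refine tendsto_of_tendsto_of_tendsto_of_le_of_le tendsto_const_nhds h0 (fun _ => zero_le)
    fun k => (volume_sdiff_innerCells_le hU k).trans (ENNReal.ofReal_le_ofReal ?_)
  refine mul_le_mul_of_nonneg_left ?_ (Nat.cast_nonneg _)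
  refine Real.rpow_le_rpow_of_exponent_le one_le_two ?_
  rw [neg_mul, neg_mul, neg_le_neg_iff]
  exact mul_le_mul_of_nonneg_left hs (Nat.cast_nonneg k)

/-- The current of integration over the cells that are new at level `k`. -/
noncomputable def layerCurrent (hU : Bornology.IsBounded U) : ℕ → Current d d
  | 0 => integrationCurrent (innerCells U 0) (hU.subset (innerCells_subset U 0))
  | k + 1 => integrationCurrent (innerCells U (k + 1) \ innerCells U k)
      (hU.subset (sdiff_subset.trans (innerCells_subset U (k + 1))))

theorem sum_layerCurrent (hU : Bornology.IsBounded U) (n : ℕ) :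
    ∑ k ∈ Finset.range (n + 1), layerCurrent hU k
      = integrationCurrent (innerCells U n) (hU.subset (innerCells_subset U n)) := by
  induction n with
  | zero => simp [layerCurrent]
  | succ n ih =>
    rw [Finset.sum_range_succ, ih, layerCurrent, ← integrationCurrent_sub
      (hU.subset (innerCells_subset U (n + 1))) (hU.subset (innerCells_subset U n))
      (innerCells_subset_succ U n) (measurableSet_innerCells U n), add_sub_cancel]

theorem isNormal_integrationCurrent_innerCells (hU : Bornology.IsBounded U) (k : ℕ) :
    (integrationCurrent (innerCells U k) (hU.subset (innerCells_subset U k))).IsNormal := by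
  obtain ⟨S, hS⟩ := exists_finset_innerCells_eq hU k
  simp only [hS]
  exact isNormal_dyadicCells k S _

theorem isNormal_layerCurrent (hU : Bornology.IsBounded U) : ∀ k, (layerCurrent hU k).IsNormal
  | 0 => isNormal_integrationCurrent_innerCells hU 0
  | k + 1 => by
    obtain ⟨S, -, hS⟩ := exists_finset_innerCells_succ_sdiff_eq hU k
    simp only [layerCurrent, hS]
    exact isNormal_dyadicCells (k + 1) S _

theorem layerCurrent_supportedIn (hU : Bornology.IsBounded U) :
    ∀ k, (layerCurrent hU k).SupportedIn (closure U)
  | 0 => integrationCurrent_supportedIn (hU.subset (innerCells_subset U 0)) ((innerCells_subset U 0).trans subset_closure)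
  | k + 1 => integrationCurrent_supportedIn
      (hU.subset (sdiff_subset.trans (innerCells_subset U (k + 1))))
      (sdiff_subset.trans ((innerCells_subset U (k + 1)).trans subset_closure))

theorem layerCurrent_succ_estimate (hU : Bornology.IsBounded U) {α : ℝ} (hα : α ∈ Icc (0 : ℝ) 1)
    (k : ℕ) :
    (layerCurrent hU (k + 1)).normalMass ^ (1 - α) * (layerCurrent hU (k + 1)).flatNorm ^ α
      ≤ ENNReal.ofReal (2 ^ d * (2 * d + 1) * (2 : ℝ) ^ (-(d - 1 + α)) *
        (boxCount (frontier U) k * (2 : ℝ) ^ (-(k : ℝ) * (d - 1 + α)))) := by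
  obtain ⟨S, hcard, hS⟩ := exists_finset_innerCells_succ_sdiff_eq hU k
  simp only [layerCurrent, hS]
  refine (normalMass_rpow_mul_flatNorm_rpow_dyadicCells_le hα (k + 1) S _).trans
    (ENNReal.ofReal_le_ofReal ?_)
  have hcard' : (S.card : ℝ) ≤ 2 ^ d * boxCount (frontier U) k := by exact_mod_cast hcard
  refine (mul_le_mul_of_nonneg_right hcard' (by positivity)).trans_eq ?_
  have h : (2 : ℝ) ^ (-((k + 1 : ℕ) : ℝ) * (d - 1 + α))
      = 2 ^ (-(d - 1 + α)) * 2 ^ (-(k : ℝ) * (d - 1 + α)) := by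
    rw [← Real.rpow_add two_pos]
    congr 1
    push_cast
    ring
  rw [h]
  ring

theorem flatNorm_sub_innerCells_le (hU : Bornology.IsBounded U) (k : ℕ) :
    (integrationCurrent U hU
      - integrationCurrent (innerCells U k) (hU.subset (innerCells_subset U k))).flatNorm
      ≤ volume (U \ innerCells U k) := by
  rw [integrationCurrent_sub hU _ (innerCells_subset U k) (measurableSet_innerCells U k)]
  exact (Current.flatNorm_le_mass _).trans (mass_integrationCurrent_le _ _)

/-- The currents of the inner unions form a sequence as in the definition of a flat current. -/
theorem flatApprox_innerCells (hU : Bornology.IsBounded U)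
    (h : Tendsto (fun k => volume (U \ innerCells U k)) atTop (𝓝 0)) :
    Current.FlatApprox (fun k =>
      integrationCurrent (innerCells U k) (hU.subset (innerCells_subset U k)))
      (integrationCurrent U hU) where
  normal := isNormal_integrationCurrent_innerCells hU
  cauchy ε hε := by
    obtain ⟨n₀, hn₀⟩ := eventually_atTop.1
      (h.eventually (eventually_le_nhds (ENNReal.half_pos hε.ne')))
    refine ⟨n₀, fun n hn k hk => ?_⟩
    rw [← sub_sub_sub_cancel_left _ _ (integrationCurrent U hU), sub_eq_add_neg]
    refine (Current.flatNorm_add_le _ _).trans ?_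
    rw [Current.flatNorm_neg, ← ENNReal.add_halves ε]
    exact add_le_add ((flatNorm_sub_innerCells_le hU k).trans (hn₀ k hk))
      ((flatNorm_sub_innerCells_le hU n).trans (hn₀ n hn))
  weak ω _ := by
    have hint := integrableOn_form hU ω (stdFrame d)
    have h0 := Integrable.tendsto_setIntegral_nhds_zero hint
      (tendsto_of_tendsto_of_tendsto_of_le_of_le tendsto_const_nhds h (fun _ => zero_le)
        fun k => Measure.restrict_apply_le _ _)
    simp only [Measure.restrict_restrict_of_subset sdiff_subset] at h0
    have h1 := tendsto_const_nhds.sub h0 (f := fun _ => integrationCurrent U hU ω)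
    rw [sub_zero] at h1
    refine h1.congr fun k => ?_
    rw [setIntegral_sdiff (measurableSet_innerCells U k) hint (innerCells_subset U k)]
    exact sub_sub_cancel _ _
  support := ⟨closure U, hU.isCompact_closure, fun k =>
    integrationCurrent_supportedIn _ ((innerCells_subset U k).trans subset_closure)⟩

end FractionalCurrents

theorem proposition3p2 (d : ℕ) (α : ℝ) (hα : α ∈ Set.Icc (0 : ℝ) 1)
    (U : Set (FractionalCurrents.E d)) (hU : IsOpen U) (hbdd : Bornology.IsBounded U)
    (hsum : FractionalCurrents.IsBoxSummable (frontier U) ((d : ℝ) - 1 + α)) :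
    FractionalCurrents.Current.IsFractional α
      (FractionalCurrents.integrationCurrent U hbdd) := by
  have hvol := FractionalCurrents.tendsto_volume_sdiff_innerCells hbdd
    (by linarith [hα.2]) hsum
  refine ⟨⟨_, FractionalCurrents.flatApprox_innerCells hbdd hvol⟩,
    FractionalCurrents.layerCurrent hbdd, FractionalCurrents.isNormal_layerCurrent hbdd,
    ⟨closure U, hbdd.isCompact_closure, FractionalCurrents.layerCurrent_supportedIn hbdd⟩, ?_, ?_⟩
  · -- Layer `0` is not controlled by the box counts; it is only known to be normal.
    rw [tsum_eq_zero_add' ENNReal.summable, ENNReal.add_lt_top]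
    constructor
    · have hN := FractionalCurrents.isNormal_layerCurrent hbdd 0
      exact ENNReal.mul_lt_top (ENNReal.rpow_lt_top_of_nonneg (sub_nonneg.2 hα.2) hN.ne)
        (ENNReal.rpow_lt_top_of_nonneg hα.1 (FractionalCurrents.Current.flatNorm_lt_top hN).ne)
    · refine (ENNReal.tsum_le_tsum
        (FractionalCurrents.layerCurrent_succ_estimate hbdd hα)).trans_lt ?_
      rw [← ENNReal.ofReal_tsum_of_nonneg (fun k => by positivity) (Summable.mul_left _ hsum)]
      exact ENNReal.ofReal_lt_top
  · -- The layers `0, …, n` add up to the current of `innerCells U n`, whence the shift by one.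
    rw [← tendsto_add_atTop_iff_nat 1]
    simp only [FractionalCurrents.sum_layerCurrent]
    exact tendsto_of_tendsto_of_tendsto_of_le_of_le tendsto_const_nhds hvol (fun _ => zero_le)
      fun k => FractionalCurrents.flatNorm_sub_innerCells_le hbdd k
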